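/- **The process.** Let $n\ge 1$. The semi-random graph process on $[n]=\{1,\dots,n\}$ starts from the empty graph $G_0$. In each step $t\ge 1$ a vertex $u_t\in[n]$ is drawn uniformly at random, independently of the past; the player then chooses a vertex $v_t\in[n]$, and the edge $u_tv_t$ is added to the multigraph $G_{t-1}$ to form $G_t$. A strategy $\mathcal S$ on $[n]$ prescribes, for every $t\ge1$, a probability distribution on $[n]$ depending on $(u_1,v_1,\dots,u_{t-1},v_{t-1},u_t)$, from which $v_t$ is drawn. Let $\mathtt{HAM}$ be the property of having a Hamiltonian cycle. For $0<q<1$ let $\tau_{\mathtt{HAM}}(\mathcal S,q,n)$ be the least $t\ge 0$ such that $\mathbb P[G_t\in\mathtt{HAM}]\ge q$ when $\mathcal S$ is followed ($\infty$ if there is no such $t$), let $\tau_{\mathtt{HAM}}(q,n)=\inf_{\mathcal S}\tau_{\mathtt{HAM}}(\mathcal S,q,n)$, the infimum being over all strategies on $[n]$, and let $$\tau_{\mathtt{HAM}}=\lim_{q\to1^-}\limsup_{n\to\infty}\frac{\tau_{\mathtt{HAM}}(q,n)}{n}\in[0,\infty],$$ where the limit exists by monotonicity in $q$. **Theorem.**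 Let $$f(s)=2+e^{-3s}(s+1)\left(1-\frac{s^2}{2}-\frac{s^3}{3}-\frac{s^4}{8}\right)+e^{-2s}\left(2s+\frac{5s^2}{2}+\frac{s^3}{2}\right)-e^{-s}(3+2s).$$ The equation $f(s)=1$ has exactly one positive root $\beta$, it satisfies $1.26575<\beta<1.26576$, and $\tau_{\mathtt{HAM}}\ge\beta$. -/

import Mathlib

open Filter Topology
open scoped ENNReal

namespace SemiRandom

/-- The history of the process on the vertex set `Fin n`: the list of the pairs (square, circle)
`(u_i, v_i)` played so far, most recent round first. -/
abbrev History (n : ℕ) : Type := List (Fin n × Fin n)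

/-- A (multi)graph on `Fin n`, as the multiset of its edges (loops and parallel edges allowed). -/
abbrev MultiGraph (n : ℕ) : Type := Multiset (Sym2 (Fin n))

/-- The multigraph formed by the edges `u_i v_i` of a history. -/
def History.graph {n : ℕ} (h : History n) : MultiGraph n :=
  Multiset.ofList (h.map fun p => s(p.1, p.2))

/-- A strategy on `n` vertices: given the history of the earlier rounds and the square `u` of the
current round, the distribution of the circle `v` of the current round. The index of the round is
determined by the length of the history. -/
abbrev Strategy (n : ℕ) : Type := History n → Fin n → PMF (Fin n)

/-- The law of the history after `t` rounds of the semi-random graph process played with the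
strategy `S`: in every round the square is uniform on the vertices and independent of the past,
and the circle is then drawn from the distribution prescribed by `S`. -/
noncomputable def historyLaw {n : ℕ} [NeZero n] (S : Strategy n) : ℕ → PMF (History n)
  | 0 => PMF.pure []
  | t + 1 => (historyLaw S t).bind fun h =>
      (PMF.uniformOfFintype (Fin n)).bind fun u => (S h u).map fun v => (u, v) :: h

/-- The law of the random multigraph `G_t` produced by the strategy `S`. -/
noncomputable def graphLaw {n : ℕ} [NeZero n] (S : Strategy n) (t : ℕ) : PMF (MultiGraph n) :=
  (historyLaw S t).map History.graph

/-- A graph property: a set of multigraphs for each number of vertices. -/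
abbrev GraphProperty : Type := (n : ℕ) → Set (MultiGraph n)

/-- `τ_P(S, q, n)`: the least `t` with `ℙ[G_t ∈ P] ≥ q`, and `∞` if there is none. -/
noncomputable def tauStrategy (P : GraphProperty) {n : ℕ} [NeZero n] (S : Strategy n) (q : ℝ) :
    ℝ≥0∞ :=
  ⨅ (t : ℕ) (_ : ENNReal.ofReal q ≤ (graphLaw S t).toOuterMeasure (P n)), (t : ℝ≥0∞)

/-- `τ_P(q, n)`: the infimum of `τ_P(S, q, n)` over all strategies `S` on `n` vertices. -/
noncomputable def tauInf (P : GraphProperty) (n : ℕ) [NeZero n] (q : ℝ) : ℝ≥0∞ :=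
  ⨅ S : Strategy n, tauStrategy P S q

/-- `limsup_{n → ∞} τ_P(q, n) / n`, over `n ≥ 1`. -/
noncomputable def tauLimsup (P : GraphProperty) (q : ℝ) : ℝ≥0∞ :=
  limsup (fun n : ℕ+ => tauInf P (n : ℕ) q / ((n : ℕ) : ℝ≥0∞)) atTop

/-- `τ_P = lim_{q → 1⁻} limsup_{n → ∞} τ_P(q, n) / n`. The limit exists: see `tendsto_tau`. -/
noncomputable def tau (P : GraphProperty) : ℝ≥0∞ :=
  limUnder (𝓝[<] (1 : ℝ)) (tauLimsup P)

theorem tauLimsup_mono (P : GraphProperty) : Monotone (tauLimsup P) := by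
  intro q₁ q₂ hq
  refine limsup_le_limsup (Eventually.of_forall fun n => ?_)
  refine ENNReal.div_le_div_right (iInf_mono fun S => iInf_mono fun t => ?_) _
  exact le_iInf fun h => iInf_le_of_le ((ENNReal.ofReal_le_ofReal hq).trans h) le_rfl

theorem tendsto_tau (P : GraphProperty) : Tendsto (tauLimsup P) (𝓝[<] (1 : ℝ)) (𝓝 (tau P)) :=
  tendsto_nhds_limUnder ⟨_, (tauLimsup_mono P).tendsto_nhdsLT 1⟩

/-- The property of having a Hamiltonian cycle. Loops and multiplicities of edges are irrelevant to
it (on at least three vertices), so it is read off the underlying simple graph. -/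
def HAM : GraphProperty := fun n =>
  {M | (SimpleGraph.fromEdgeSet {e : Sym2 (Fin n) | e ∈ M}).IsHamiltonian}

/-- The function `f` whose positive root of `f(s) = 1` is the lower bound. -/
noncomputable def f (s : ℝ) : ℝ :=
  2 + Real.exp (-3 * s) * (s + 1) * (1 - s ^ 2 / 2 - s ^ 3 / 3 - s ^ 4 / 8)
    + Real.exp (-2 * s) * (2 * s + 5 * s ^ 2 / 2 + s ^ 3 / 2)
    - Real.exp (-s) * (3 + 2 * s)

end SemiRandom

/-! A Hamiltonian cycle has `n` edges, and at most `2|A|` of them meet a given vertex set `A`. Take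
for `A` the saturated vertices and charge each edge avoiding `A` to the vertex of its square.
Saturated vertices carry at least two squares and the others at most two, so Hamiltonicity forces `∑
min(squares, 2)` to be at least `n` plus the number of squares on unsaturated vertices that pay for
no such edge. Wasted rounds are squares of this kind (`le_of_graph_mem_HAM`).

No strategy avoids waste. Whichever circle `v` answers the first square on `u`, later squares are
uniform, so with a known probability `u` gets none or one more while `v` gets two more and becomes
saturated. If `u` ends with two squares, it must also have had no circle before its first; after `i`
rounds at most `i` vertices without squares are lost to this condition. This bounds the expected
waste below for every strategy (`le_expect_wastedCount`).

Hence `n * ℙ[HAM]` is at most the mean of `∑ min(squares, 2)` minus the mean waste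
(`mul_expect_HAM_le`). For `t = s n`, after division by `n`, this upper bound tends to `2 - (2 + s)
exp (-s)` minus the integrals of `wasteOne s` over `[0, s]` and of `wasteTwo s` over `[s - 1/2, s]`.
At `s = 1.266` the limit is below `0.998` (`waste_bound`), so `τ ≥ 1.266`. The function `f` enters
only through its root `β < 1.26576 < 1.266`, located by monotonicity and rational estimates. -/

namespace SemiRandom

/-! ### Conditional expectations given the history -/

/-- The expectation of `F` at the history after `k` further rounds, starting from a history. -/
noncomputable def expect {n : ℕ} (S : Strategy n) : ℕ → (History n → ℝ) → History n → ℝ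
  | 0, F => F
  | k + 1, F => fun h => ∑ u, ∑ v, (n : ℝ)⁻¹ * (S h u v).toReal * expect S k F ((u, v) :: h)

/-- The law of the history after `k` further rounds, by recursion on the first of these rounds. -/
noncomputable def lawFrom {n : ℕ} [NeZero n] (S : Strategy n) : ℕ → History n → PMF (History n)
  | 0, h => PMF.pure h
  | k + 1, h => (PMF.uniformOfFintype (Fin n)).bind fun u => (S h u).bind fun v =>
      lawFrom S k ((u, v) :: h)

/-- Reconciles the recursion on the last round, which defines the process, with the recursion on the
next round, which suits conditioning on the past. -/
theorem historyLaw_bind_lawFrom {n : ℕ} [NeZero n] (S : Strategy n) (k t : ℕ) :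
    (historyLaw S t).bind (lawFrom S k) = historyLaw S (t + k) := by
  induction k generalizing t with
  | zero => simp [lawFrom, PMF.bind_pure]
  | succ k ih =>
    rw [show t + (k + 1) = (t + 1) + k by ring, ← ih (t + 1)]
    simp [historyLaw, lawFrom, PMF.bind_bind, PMF.bind_map, Function.comp_def]

theorem lawFrom_nil {n : ℕ} [NeZero n] (S : Strategy n) (t : ℕ) :
    lawFrom S t [] = historyLaw S t := by
  have h := historyLaw_bind_lawFrom S t 0
  simpa [historyLaw, PMF.pure_bind] using h

theorem sum_toReal_eq_one {α : Type*} [Fintype α] (p : PMF α) : ∑ v, (p v).toReal = 1 := by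
  rw [← ENNReal.toReal_sum fun a _ => p.apply_ne_top a, ← tsum_fintype (L := .unconditional _),
    p.tsum_coe, ENNReal.toReal_one]

section

variable {n : ℕ} (S : Strategy n)

theorem expect_mono {k : ℕ} {F G : History n → ℝ} {h : History n}
    (hFG : ∀ l : History n, l.length = k → F (l ++ h) ≤ G (l ++ h)) :
    expect S k F h ≤ expect S k G h := by
  induction k generalizing h with
  | zero => simpa [expect] using hFG [] rfl
  | succ k ih =>
    refine Finset.sum_le_sum fun u _ => Finset.sum_le_sum fun v _ => ?_
    refine mul_le_mul_of_nonneg_left (ih fun l hl => ?_) (by positivity)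
    simpa using hFG (l ++ [(u, v)]) (by simp [hl])

theorem expect_congr {k : ℕ} {F G : History n → ℝ} {h : History n}
    (hFG : ∀ l : History n, l.length = k → F (l ++ h) = G (l ++ h)) :
    expect S k F h = expect S k G h :=
  le_antisymm (expect_mono S fun l hl => (hFG l hl).le) (expect_mono S fun l hl => (hFG l hl).ge)

theorem expect_add (k : ℕ) (F G : History n → ℝ) (h : History n) :
    expect S k (fun H => F H + G H) h = expect S k F h + expect S k G h := by
  induction k generalizing h with
  | zero => rfl
  | succ k ih => simp only [expect, ih, mul_add, Finset.sum_add_distrib]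

theorem expect_const_mul (k : ℕ) (c : ℝ) (F : History n → ℝ) (h : History n) :
    expect S k (fun H => c * F H) h = c * expect S k F h := by
  induction k generalizing h with
  | zero => rfl
  | succ k ih =>
    simp only [expect, ih, Finset.mul_sum]
    exact Finset.sum_congr rfl fun u _ => Finset.sum_congr rfl fun v _ => by ring

theorem expect_sub (k : ℕ) (F G : History n → ℝ) (h : History n) :
    expect S k (fun H => F H - G H) h = expect S k F h - expect S k G h := by
  have := expect_add S k F (fun H => (-1) * G H) h
  rw [expect_const_mul] at this
  simpa [sub_eq_add_neg] using this

theorem expect_sum {ι : Type*} (s : Finset ι) (k : ℕ) (F : ι → History n → ℝ) (h : History n) :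
    expect S k (fun H => ∑ i ∈ s, F i H) h = ∑ i ∈ s, expect S k (F i) h := by
  classical
  induction s using Finset.induction_on with
  | empty => simpa using expect_const_mul S k 0 (fun _ => 0) h
  | insert a s ha ih => simp only [Finset.sum_insert ha, expect_add, ih]

/-- One round, when the value depends on the square only. -/
theorem expect_succ_of_square {k : ℕ} {F : History n → ℝ} {h : History n} {g : Fin n → ℝ}
    (hg : ∀ u v, expect S k F ((u, v) :: h) = g u) :
    expect S (k + 1) F h = (n : ℝ)⁻¹ * ∑ u, g u := by
  simp only [expect, hg, ← Finset.sum_mul, ← Finset.mul_sum, sum_toReal_eq_one, mul_one]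

theorem le_expect_succ_of_square {k : ℕ} {F : History n → ℝ} {h : History n} {g : Fin n → ℝ}
    (hg : ∀ u v, g u ≤ expect S k F ((u, v) :: h)) :
    (n : ℝ)⁻¹ * ∑ u, g u ≤ expect S (k + 1) F h := by
  have : (n : ℝ)⁻¹ * ∑ u, g u = ∑ u, ∑ v, (n : ℝ)⁻¹ * (S h u v).toReal * g u := by
    simp only [← Finset.sum_mul, ← Finset.mul_sum, sum_toReal_eq_one, mul_one]
  rw [this]
  exact Finset.sum_le_sum fun u _ => Finset.sum_le_sum fun v _ =>
    mul_le_mul_of_nonneg_left (hg u v) (by positivity)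

theorem expect_const [NeZero n] (k : ℕ) (c : ℝ) (h : History n) :
    expect S k (fun _ => c) h = c := by
  induction k generalizing h with
  | zero => rfl
  | succ k ih =>
    rw [expect_succ_of_square S fun u v => ih _]
    simp [NeZero.ne n]

theorem toOuterMeasure_lawFrom [NeZero n] (k : ℕ) (P : Set (History n)) (h : History n) :
    (lawFrom S k h).toOuterMeasure P = ENNReal.ofReal (expect S k (P.indicator 1) h) := by
  classical
  induction k generalizing h with
  | zero =>
    by_cases hP : h ∈ P <;> simp [lawFrom, expect, PMF.toOuterMeasure_pure_apply, hP]
  | succ k ih =>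
    have hnn : ∀ h, 0 ≤ expect S k (P.indicator 1) h := fun h => by
      rw [← expect_const S k 0 h]
      exact expect_mono S fun l _ => Set.indicator_nonneg (by simp) _
    simp only [lawFrom, expect, PMF.toOuterMeasure_bind_apply, ih, tsum_fintype,
      PMF.uniformOfFintype_apply, Fintype.card_fin]
    rw [ENNReal.ofReal_sum_of_nonneg fun u _ => Finset.sum_nonneg fun v _ => by
      have := hnn ((u, v) :: h); positivity]
    refine Finset.sum_congr rfl fun u _ => ?_
    rw [ENNReal.ofReal_sum_of_nonneg fun v _ => by have := hnn ((u, v) :: h); positivity,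
      Finset.mul_sum]
    refine Finset.sum_congr rfl fun v _ => ?_
    rw [ENNReal.ofReal_mul (by positivity), ENNReal.ofReal_mul (by positivity),
      ENNReal.ofReal_toReal (PMF.apply_ne_top _ _), ENNReal.ofReal_inv_of_pos
        (by exact_mod_cast Nat.pos_of_ne_zero (NeZero.ne n)), ENNReal.ofReal_natCast, mul_assoc]

theorem toOuterMeasure_graphLaw [NeZero n] (t : ℕ) (P : Set (MultiGraph n)) :
    (graphLaw S t).toOuterMeasure P
      = ENNReal.ofReal (expect S t ((History.graph ⁻¹' P).indicator 1) []) := by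
  rw [graphLaw, PMF.toOuterMeasure_map_apply, ← lawFrom_nil, toOuterMeasure_lawFrom]

end

/-! ### The deterministic inequality for Hamiltonian histories -/

-- The cycle has as many edges as vertices, and each vertex of `s` lies on only two of them.
open scoped Classical in
theorem card_le_of_isHamiltonianCycle {V : Type*} [Fintype V] [DecidableEq V] {G : SimpleGraph V}
    {a : V} {p : G.Walk a a} (hp : p.IsHamiltonianCycle) (s : Finset V) :
    Fintype.card V ≤ 2 * s.card + (p.edges.toFinset.filter fun e => ∀ x ∈ e, x ∉ s).card := by
  have hcard : p.edges.toFinset.card = Fintype.card V := by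
    rw [List.toFinset_card_of_nodup hp.isCycle.edges_nodup, SimpleGraph.Walk.length_edges,
      hp.length_eq]
  have hdeg : ∀ x ∈ s, (p.edges.toFinset.filter fun e => x ∈ e).card ≤ 2 := by
    intro x _
    have h2 := hp.isCycle.ncard_neighborSet_toSubgraph_eq_two (hp.mem_support x)
    have hfin := SimpleGraph.Walk.finite_neighborSet_toSubgraph p (w := x)
    rw [Set.ncard_eq_toFinset_card _ hfin] at h2
    rw [← h2]
    refine (Finset.card_le_card (t := hfin.toFinset.image fun y => s(x, y)) ?_).trans
      Finset.card_image_le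
    intro e he
    rw [Finset.mem_filter, List.mem_toFinset] at he
    obtain ⟨y, rfl⟩ := he.2
    refine Finset.mem_image.2 ⟨y, ?_, rfl⟩
    simpa [SimpleGraph.Walk.adj_toSubgraph_iff_mem_edges] using he.1
  have hsub : p.edges.toFinset ⊆ (s.biUnion fun x => p.edges.toFinset.filter fun e => x ∈ e) ∪
      p.edges.toFinset.filter fun e => ∀ x ∈ e, x ∉ s := by
    intro e he
    by_cases h : ∀ x ∈ e, x ∉ s
    · exact Finset.mem_union_right _ (Finset.mem_filter.2 ⟨he, h⟩)
    · push Not at h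
      obtain ⟨x, hxe, hxs⟩ := h
      exact Finset.mem_union_left _ (Finset.mem_biUnion.2 ⟨x, hxs, Finset.mem_filter.2 ⟨he, hxe⟩⟩)
  have h1 := Finset.card_le_card hsub
  have h2 := Finset.card_union_le (s.biUnion fun x => p.edges.toFinset.filter fun e => x ∈ e)
    (p.edges.toFinset.filter fun e => ∀ x ∈ e, x ∉ s)
  have h3 := Finset.card_biUnion_le_card_mul s _ 2 hdeg
  lia

/-- The number of squares on `x`. -/
def squares {n : ℕ} (h : History n) (x : Fin n) : ℕ := (h.map Prod.fst).count x

section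

variable {n : ℕ}

@[simp] theorem squares_nil (x : Fin n) : squares [] x = 0 := rfl

theorem squares_cons (u v : Fin n) (h : History n) (x : Fin n) :
    squares ((u, v) :: h) x = squares h x + if u = x then 1 else 0 := by
  simp [squares, List.count_cons]

theorem squares_le_of_suffix {h H : History n} (hs : h <:+ H) (x : Fin n) :
    squares h x ≤ squares H x :=
  (hs.sublist.map _).count_le x

/-- A vertex is fresh if it had no circle when it got its first square. -/
def Fresh (H : History n) (x : Fin n) : Prop :=
  ∃ v past, (x, v) :: past <:+ H ∧ squares past x = 0 ∧ x ∉ past.map Prod.snd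

/-- The vertices with at least three squares, and those with two squares which are not fresh. -/
def Saturated (H : History n) (x : Fin n) : Prop :=
  3 ≤ squares H x ∨ squares H x = 2 ∧ ¬ Fresh H x

/-- A round `(u, v)`, played after `past`, which is wasted in the final history `H`. -/
def Wasted (H past : History n) (u v : Fin n) : Prop :=
  squares past u = 0 ∧ (squares H u = 1 ∨ u ∉ past.map Prod.snd ∧ squares H u = 2) ∧
    (u = v ∨ squares ((u, v) :: past) v + 2 ≤ squares H v)

open scoped Classical in
/-- The number of the wasted rounds of a suffix of `H`. -/
noncomputable def wastedCount (H : History n) : History n → ℕ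
  | [] => 0
  | (u, v) :: past => (if Wasted H past u v then 1 else 0) + wastedCount H past

theorem Wasted.not_saturated {H past : History n} {u v : Fin n} (hs : (u, v) :: past <:+ H)
    (h : Wasted H past u v) : ¬ Saturated H u := by
  obtain ⟨h0, h1 | ⟨hc, h2⟩, -⟩ := h
  · rintro (h | ⟨h, -⟩) <;> lia
  · rintro (h | ⟨-, h⟩)
    · lia
    · exact h ⟨v, past, hs, h0, hc⟩

theorem Wasted.eq_or_saturated {H past : History n} {u v : Fin n} (hs : (u, v) :: past <:+ H)
    (h : Wasted H past u v) : u = v ∨ Saturated H v := by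
  obtain ⟨-, -, rfl | h2⟩ := h
  · exact .inl rfl
  by_cases huv : u = v
  · exact .inl huv
  refine .inr ?_
  by_cases h3 : 3 ≤ squares H v
  · exact .inl h3
  refine .inr ⟨by lia, ?_⟩
  rintro ⟨w, past', hs', h0, hc⟩
  -- Both squares of `v` come after this round. A round making `v` fresh would lie either later,
  -- when `v` already has the circle of this round, or earlier, giving `v` a third square.
  have hv0 : squares ((u, v) :: past) v = 0 := by lia
  rcases List.suffix_or_suffix_of_suffix hs hs' with h | h
  · rcases List.suffix_cons_iff.1 h with h | h
    · simp only [List.cons.injEq, Prod.mk.injEq] at h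
      exact huv h.1.1
    · exact hc (List.mem_map.2 ⟨(u, v), h.subset (by simp), rfl⟩)
  · have := squares_le_of_suffix h v
    rw [squares_cons v w] at this
    simp at this
    lia

-- Each round contributes at most one on the left: a wasted round is a loop or has a saturated
-- circle, so it is not counted by `countP`. Either kind of round has its square on an unsaturated
-- vertex.
open scoped Classical in
theorem countP_add_wastedCount_le {H h : History n} (hs : h <:+ H) :
    h.countP (fun e => e.1 ≠ e.2 ∧ ¬ Saturated H e.1 ∧ ¬ Saturated H e.2) + wastedCount H h
      ≤ ∑ x with ¬ Saturated H x, squares h x := by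
  induction h with
  | nil => simp [wastedCount]
  | cons e past ih =>
    obtain ⟨u, v⟩ := e
    have ih := ih ((List.suffix_cons _ _).trans hs)
    have hsum : ∑ x with ¬ Saturated H x, squares ((u, v) :: past) x
        = ∑ x with ¬ Saturated H x, squares past x + if ¬ Saturated H u then 1 else 0 := by
      simp only [squares_cons, Finset.sum_add_distrib, Finset.sum_ite_eq, Finset.mem_filter,
        Finset.mem_univ, true_and]
    rw [hsum, List.countP_cons, wastedCount]
    have hw1 := fun h => Wasted.not_saturated (H := H) (past := past) (u := u) (v := v) hs h
    have hw2 := fun h => Wasted.eq_or_saturated (H := H) (past := past) (u := u) (v := v) hs h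
    by_cases hu : Saturated H u <;> by_cases hv : Saturated H v <;> by_cases huv : u = v <;>
      by_cases hw : Wasted H past u v <;> simp_all <;> lia

open scoped Classical in
theorem two_mul_card_add_countP_add_wastedCount_le (H : History n) :
    2 * (Finset.univ.filter (Saturated H)).card
      + H.countP (fun e => e.1 ≠ e.2 ∧ ¬ Saturated H e.1 ∧ ¬ Saturated H e.2) + wastedCount H H
      ≤ ∑ x, min (squares H x) 2 := by
  have h := countP_add_wastedCount_le (List.suffix_refl H)
  rw [← Finset.sum_filter_add_sum_filter_not Finset.univ (Saturated H)]
  have h1 : ∑ x with Saturated H x, min (squares H x) 2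
      = 2 * (Finset.univ.filter (Saturated H)).card := by
    rw [Finset.sum_congr rfl (g := fun _ => 2), Finset.sum_const, smul_eq_mul, mul_comm]
    rintro x hx
    rcases (Finset.mem_filter.1 hx).2 with h | h <;> lia
  have h2 : ∑ x with ¬ Saturated H x, min (squares H x) 2
      = ∑ x with ¬ Saturated H x, squares H x := by
    refine Finset.sum_congr rfl fun x hx => ?_
    have hx := (Finset.mem_filter.1 hx).2
    have : ¬ 3 ≤ squares H x := fun h => hx (.inl h)
    lia
  lia

open scoped Classical in
theorem le_of_graph_mem_HAM (hn : 2 ≤ n) {H : History n} (hH : H.graph ∈ HAM n) :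
    n + wastedCount H H ≤ ∑ x, min (squares H x) 2 := by
  -- Hamiltonicity provides a cycle only when there is not exactly one vertex.
  obtain ⟨a, p, hp⟩ := hH (by simp; lia)
  have h1 := card_le_of_isHamiltonianCycle hp (Finset.univ.filter (Saturated H))
  have h2 := two_mul_card_add_countP_add_wastedCount_le H
  rw [Fintype.card_fin] at h1
  have h3 : (p.edges.toFinset.filter
      fun e => ∀ x ∈ e, x ∉ Finset.univ.filter (Saturated H)).card
      ≤ H.countP (fun e => e.1 ≠ e.2 ∧ ¬ Saturated H e.1 ∧ ¬ Saturated H e.2) := by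
    rw [List.countP_eq_length_filter, ← List.length_map (fun e : Fin n × Fin n => s(e.1, e.2))]
    refine (Finset.card_le_card ?_).trans (List.toFinset_card_le _)
    intro e he
    rw [Finset.mem_filter, List.mem_toFinset] at he
    obtain ⟨he, hes⟩ := he
    have hG := p.edges_subset_edgeSet he
    rw [SimpleGraph.edgeSet_fromEdgeSet] at hG
    obtain ⟨hM, hd⟩ := hG
    simp only [History.graph, Multiset.mem_coe, Set.mem_ofPred_eq, List.mem_map] at hM
    obtain ⟨⟨u, v⟩, hmem, rfl⟩ := hM
    rw [List.mem_toFinset, List.mem_map]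
    refine ⟨(u, v), List.mem_filter.2 ⟨hmem, ?_⟩, rfl⟩
    have hu := hes u (by simp)
    have hv := hes v (by simp)
    simp_all
  lia

theorem graph_mem_HAM_cons {e : Fin n × Fin n} {h : History n} (hh : h.graph ∈ HAM n) :
    History.graph (e :: h) ∈ HAM n := by
  refine SimpleGraph.IsHamiltonian.mono (SimpleGraph.fromEdgeSet_mono ?_) hh
  intro x hx
  simp only [History.graph, Multiset.mem_coe, Set.mem_ofPred_eq, List.map_cons, List.mem_cons]
    at hx ⊢
  exact .inr hx

end

/-! ### Squares on one and on two given vertices -/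

/-- One round for the number of squares on a vertex, acting on functions of that number. -/
noncomputable def singleStep (n : ℕ) (g : ℕ → ℝ) (i : ℕ) : ℝ :=
  (n : ℝ)⁻¹ * g (i + 1) + (1 - (n : ℝ)⁻¹) * g i

/-- One round for the numbers of squares on two vertices, acting on functions of them. -/
noncomputable def pairStep (n : ℕ) (g : ℕ → ℕ → ℝ) (i j : ℕ) : ℝ :=
  (n : ℝ)⁻¹ * (g (i + 1) j + g i (j + 1)) + (1 - 2 * (n : ℝ)⁻¹) * g i j

section

variable {n : ℕ} [NeZero n] (S : Strategy n)

theorem expect_single (g : ℕ → ℝ) (u : Fin n) (k : ℕ) (h : History n) :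
    expect S k (fun H => g (squares H u)) h = (singleStep n)^[k] g (squares h u) := by
  induction k generalizing h with
  | zero => rfl
  | succ k ih =>
    rw [Function.iterate_succ_apply', singleStep]
    set G := (singleStep n)^[k] g
    rw [expect_succ_of_square S (g := fun w => G (squares h u)
      + if w = u then G (squares h u + 1) - G (squares h u) else 0)]
    · have hn : (n : ℝ) ≠ 0 := by exact_mod_cast NeZero.ne n
      simp only [Finset.sum_add_distrib, Finset.sum_const, Finset.card_univ, Fintype.card_fin,
        Finset.sum_ite_eq', Finset.mem_univ, if_true, nsmul_eq_mul]
      field_simp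
      ring
    · intro w x
      rw [ih, squares_cons]
      split_ifs <;> simp

/-- The offsets `c` and `d` allow counting only the squares received from some moment on; `hc` and
`hd` keep the truncated subtractions exact. -/
theorem expect_pair (g : ℕ → ℕ → ℝ) {u v : Fin n} (huv : u ≠ v) {c d : ℕ} (k : ℕ)
    (h : History n) (hc : c ≤ squares h u) (hd : d ≤ squares h v) :
    expect S k (fun H => g (squares H u - c) (squares H v - d)) h
      = (pairStep n)^[k] g (squares h u - c) (squares h v - d) := by
  induction k generalizing h with
  | zero => rfl
  | succ k ih =>
    rw [Function.iterate_succ_apply', pairStep]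
    set G := (pairStep n)^[k] g
    set i := squares h u - c with hi
    set j := squares h v - d with hj
    rw [expect_succ_of_square S (g := fun w => G i j
      + (if w = u then G (i + 1) j - G i j else 0) + if w = v then G i (j + 1) - G i j else 0)]
    · have hn : (n : ℝ) ≠ 0 := by exact_mod_cast NeZero.ne n
      simp only [Finset.sum_add_distrib, Finset.sum_const, Finset.card_univ, Fintype.card_fin,
        Finset.sum_ite_eq', Finset.mem_univ, if_true, nsmul_eq_mul]
      field_simp
      ring
    · intro w x
      have hu := squares_cons w x h u
      have hv := squares_cons w x h v
      rw [ih _ (by lia) (by lia)]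
      by_cases hwu : w = u
      · subst hwu
        rw [show squares ((w, x) :: h) w - c = i + 1 by simp_all; lia,
          show squares ((w, x) :: h) v - d = j by simp_all]
        simp [huv]
      · by_cases hwv : w = v
        · subst hwv
          rw [show squares ((w, x) :: h) w - d = j + 1 by simp_all; lia,
            show squares ((w, x) :: h) u - c = i by simp_all]
          simp [hwu]
        · rw [show squares ((w, x) :: h) u - c = i by simp_all,
            show squares ((w, x) :: h) v - d = j by simp_all]
          simp [hwu, hwv]

end

theorem natCast_mul_pow_pred_mul (k : ℕ) (x : ℝ) : (k : ℝ) * x ^ (k - 1) * x = k * x ^ k := by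
  cases k with
  | zero => simp
  | succ k => rw [Nat.add_sub_cancel, mul_assoc, ← pow_succ]

theorem natCast_mul_pow_pred_pred_mul (k : ℕ) (x : ℝ) :
    (k : ℝ) * (k - 1) * x ^ (k - 2) * x = k * (k - 1) * x ^ (k - 1) := by
  rcases k with _ | _ | k
  · simp
  · simp
  · rw [show k + 1 + 1 - 2 = k by lia, show k + 1 + 1 - 1 = k + 1 by lia, mul_assoc, ← pow_succ]

/-- The probability that in `k` rounds the first of two vertices gets no square and the second at
least two. -/
noncomputable def probZeroTwo (n k : ℕ) : ℝ :=
  (1 - (n : ℝ)⁻¹) ^ k - (1 - 2 * (n : ℝ)⁻¹) ^ k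
    - (n : ℝ)⁻¹ * (k * (1 - 2 * (n : ℝ)⁻¹) ^ (k - 1))

/-- The probability that in `k` rounds the first of two vertices gets one square and the second at
least two. -/
noncomputable def probOneTwo (n k : ℕ) : ℝ :=
  (n : ℝ)⁻¹ * (k * (1 - (n : ℝ)⁻¹) ^ (k - 1)) - (n : ℝ)⁻¹ * (k * (1 - 2 * (n : ℝ)⁻¹) ^ (k - 1))
    - (n : ℝ)⁻¹ ^ 2 * (k * (k - 1) * (1 - 2 * (n : ℝ)⁻¹) ^ (k - 2))

/-- The induction needs the value at every starting count, not only at `0`. At `k = 0` the truncated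
exponent `k - 1` is harmless, its coefficient being zero. -/
theorem iterate_singleStep_min (n k : ℕ) :
    (singleStep n)^[k] (fun i => (min i 2 : ℕ)) = fun i => match i with
      | 0 => 2 - 2 * (1 - (n : ℝ)⁻¹) ^ k - (n : ℝ)⁻¹ * (k * (1 - (n : ℝ)⁻¹) ^ (k - 1))
      | 1 => 2 - (1 - (n : ℝ)⁻¹) ^ k
      | _ => 2 := by
  induction k with
  | zero =>
    funext i
    rcases i with _ | _ | i
    · simp
    · norm_num
    · change ((min (i + 2) 2 : ℕ) : ℝ) = 2
      rw [Nat.min_eq_right (by lia), Nat.cast_ofNat]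
  | succ k ih =>
    rw [Function.iterate_succ_apply', ih]
    have h1 := natCast_mul_pow_pred_mul k (1 - (n : ℝ)⁻¹)
    funext i
    rcases i with _ | _ | i
    · simp only [singleStep, Nat.add_sub_cancel, pow_succ]
      push_cast
      linear_combination (-(n : ℝ)⁻¹) * h1
    · simp only [singleStep, pow_succ]
      ring
    · simp only [singleStep]
      ring

theorem iterate_pairStep_zero_two (n k : ℕ) :
    (pairStep n)^[k] (fun i j => if i = 0 ∧ 2 ≤ j then 1 else 0) = fun i j => match i, j with
      | 0, 0 => probZeroTwo n k
      | 0, 1 => (1 - (n : ℝ)⁻¹) ^ k - (1 - 2 * (n : ℝ)⁻¹) ^ k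
      | 0, _ => (1 - (n : ℝ)⁻¹) ^ k
      | _, _ => 0 := by
  induction k with
  | zero =>
    funext i j
    rcases i with _ | i <;> rcases j with _ | _ | j <;> simp [probZeroTwo]
  | succ k ih =>
    rw [Function.iterate_succ_apply', ih]
    have h1 := natCast_mul_pow_pred_mul k (1 - 2 * (n : ℝ)⁻¹)
    funext i j
    rcases i with _ | i <;> rcases j with _ | _ | j <;>
      simp only [pairStep, probZeroTwo, Nat.add_sub_cancel, pow_succ] <;> push_cast
    · linear_combination (-(n : ℝ)⁻¹) * h1
    all_goals ring

theorem iterate_pairStep_one_two (n k : ℕ) :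
    (pairStep n)^[k] (fun i j => if i = 1 ∧ 2 ≤ j then 1 else 0) = fun i j => match i, j with
      | 0, 0 => probOneTwo n k
      | 0, 1 => (n : ℝ)⁻¹ * (k * (1 - (n : ℝ)⁻¹) ^ (k - 1))
          - (n : ℝ)⁻¹ * (k * (1 - 2 * (n : ℝ)⁻¹) ^ (k - 1))
      | 0, _ => (n : ℝ)⁻¹ * (k * (1 - (n : ℝ)⁻¹) ^ (k - 1))
      | 1, 0 => probZeroTwo n k
      | 1, 1 => (1 - (n : ℝ)⁻¹) ^ k - (1 - 2 * (n : ℝ)⁻¹) ^ k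
      | 1, _ => (1 - (n : ℝ)⁻¹) ^ k
      | _, _ => 0 := by
  induction k with
  | zero =>
    funext i j
    rcases i with _ | _ | i <;> rcases j with _ | _ | j <;> simp [probZeroTwo, probOneTwo]
  | succ k ih =>
    rw [Function.iterate_succ_apply', ih]
    have h1 := natCast_mul_pow_pred_mul k (1 - 2 * (n : ℝ)⁻¹)
    have h2 := natCast_mul_pow_pred_mul k (1 - (n : ℝ)⁻¹)
    have h3 := natCast_mul_pow_pred_pred_mul k (1 - 2 * (n : ℝ)⁻¹)
    funext i j
    rcases i with _ | _ | i <;> rcases j with _ | _ | j <;>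
      simp only [pairStep, probZeroTwo, probOneTwo, Nat.add_sub_cancel, pow_succ,
        show k + 1 - 2 = k - 1 by lia] <;> push_cast
    · linear_combination (n : ℝ)⁻¹ * h2 - (n : ℝ)⁻¹ * h1 - (n : ℝ)⁻¹ ^ 2 * h3
    · linear_combination (n : ℝ)⁻¹ * h2 - (n : ℝ)⁻¹ * h1
    · linear_combination (n : ℝ)⁻¹ * h2
    · linear_combination (-(n : ℝ)⁻¹) * h1
    all_goals ring

theorem two_mul_inv_le_one {n : ℕ} (hn : 2 ≤ n) : 2 * (n : ℝ)⁻¹ ≤ 1 := by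
  rw [← div_eq_mul_inv, div_le_one (by positivity)]
  exact_mod_cast hn

theorem iterate_pairStep_nonneg {n : ℕ} (hn : 2 ≤ n) {g : ℕ → ℕ → ℝ} (hg : ∀ i j, 0 ≤ g i j)
    (k i j : ℕ) : 0 ≤ (pairStep n)^[k] g i j := by
  induction k generalizing i j with
  | zero => exact hg i j
  | succ k ih =>
    rw [Function.iterate_succ_apply', pairStep]
    have h1 := ih (i + 1) j
    have h2 := ih i (j + 1)
    have h3 := ih i j
    have h4 := sub_nonneg.2 (two_mul_inv_le_one hn)
    positivity

theorem probOneTwo_nonneg {n : ℕ} (hn : 2 ≤ n) (k : ℕ) : 0 ≤ probOneTwo n k := by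
  have h := iterate_pairStep_nonneg hn (g := fun i j => if i = 1 ∧ 2 ≤ j then 1 else 0)
    (fun i j => by positivity) k 0 0
  rwa [iterate_pairStep_one_two] at h

/-! ### The expected number of wasted rounds -/

section

variable {n : ℕ}

/-- The number of vertices without squares. -/
def unhit (h : History n) : ℕ := (Finset.univ.filter fun x => squares h x = 0).card

theorem unhit_cons (u v : Fin n) (h : History n) :
    (unhit ((u, v) :: h) : ℝ) = unhit h - if squares h u = 0 then 1 else 0 := by
  unfold unhit
  have : (Finset.univ.filter fun x => squares ((u, v) :: h) x = 0)
      = (Finset.univ.filter fun x => squares h x = 0).erase u := by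
    ext x
    simp only [squares_cons, Finset.mem_filter, Finset.mem_univ, true_and, Finset.mem_erase]
    by_cases hux : u = x
    · simp [hux]
    · simp [hux, Ne.symm hux]
  rw [this]
  by_cases h0 : squares h u = 0
  · have hm : u ∈ Finset.univ.filter fun x => squares h x = 0 := by simp [h0]
    rw [if_pos h0, ← Finset.card_erase_add_one hm]
    simp
  · rw [if_neg h0, Finset.erase_eq_of_notMem (by simp [h0]), sub_zero]

/-- Each round places one circle, so it spoils at most one vertex. -/
theorem unhit_sub_length_le (h : History n) :
    (unhit h : ℝ) - h.length
      ≤ (Finset.univ.filter fun x => squares h x = 0 ∧ x ∉ h.map Prod.snd).card := by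
  rw [sub_le_iff_le_add]
  have h1 : (Finset.univ.filter fun x => squares h x = 0)
      ⊆ (Finset.univ.filter fun x => squares h x = 0 ∧ x ∉ h.map Prod.snd)
        ∪ (h.map Prod.snd).toFinset := by
    intro x hx
    by_cases hc : x ∈ h.map Prod.snd
    · exact Finset.mem_union_right _ (List.mem_toFinset.2 hc)
    · exact Finset.mem_union_left _ (Finset.mem_filter.2 ⟨Finset.mem_univ _,
        (Finset.mem_filter.1 hx).2, hc⟩)
  have h2 := (Finset.card_le_card h1).trans (Finset.card_union_le _ _)
  have h3 := List.toFinset_card_le (h.map Prod.snd)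
  rw [List.length_map] at h3
  unfold unhit
  exact_mod_cast h2.trans (Nat.add_le_add_left h3 _)

end

section

variable {n : ℕ} [NeZero n] (S : Strategy n)

theorem expect_zero_two {u v : Fin n} (huv : u ≠ v) (k : ℕ) (h : History n) :
    expect S k (fun H => if squares H u - squares h u = 0 ∧ 2 ≤ squares H v - squares h v
      then 1 else 0) h = probZeroTwo n k := by
  rw [expect_pair S (fun i j => if i = 0 ∧ 2 ≤ j then 1 else 0) huv k h le_rfl le_rfl,
    iterate_pairStep_zero_two]
  simp

theorem expect_one_two {u v : Fin n} (huv : u ≠ v) (k : ℕ) (h : History n) :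
    expect S k (fun H => if squares H u - squares h u = 1 ∧ 2 ≤ squares H v - squares h v
      then 1 else 0) h = probOneTwo n k := by
  rw [expect_pair S (fun i j => if i = 1 ∧ 2 ≤ j then 1 else 0) huv k h le_rfl le_rfl,
    iterate_pairStep_one_two]
  simp

-- The future squares do not depend on the choice of `v`, so the two disjoint ways of being wasted
-- have probabilities known in advance.
open scoped Classical in
theorem le_expect_wasted (hn : 2 ≤ n) (k : ℕ) (past : History n) (u v : Fin n) :
    (if squares past u = 0 then probZeroTwo n k else 0)
      + (if squares past u = 0 ∧ u ∉ past.map Prod.snd then probOneTwo n k else 0)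
      ≤ expect S k (fun H => if Wasted H past u v then 1 else 0) ((u, v) :: past) := by
  by_cases h0 : squares past u = 0
  · obtain ⟨w, hw, hwv⟩ : ∃ w, u ≠ w ∧ (u = v ∨ w = v) := by
      by_cases huv : u = v
      · have : Nontrivial (Fin n) := Fin.nontrivial_iff_two_le.2 hn
        obtain ⟨w, hw⟩ := exists_ne u
        exact ⟨w, hw.symm, .inl huv⟩
      · exact ⟨v, huv, .inr rfl⟩
    have hu : squares ((u, v) :: past) u = 1 := by simp [squares_cons, h0]
    by_cases hc : u ∈ past.map Prod.snd
    · rw [if_pos h0, if_neg (by tauto), add_zero, ← expect_zero_two S hw k ((u, v) :: past)]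
      refine expect_mono S fun l _ => ?_
      have hsu := squares_le_of_suffix (List.suffix_append l ((u, v) :: past)) u
      split_ifs with h1 h2 <;> try norm_num
      refine h2 ⟨h0, .inl (by lia), hwv.imp id ?_⟩
      rintro rfl
      lia
    · rw [if_pos h0, if_pos ⟨h0, hc⟩, ← expect_zero_two S hw k ((u, v) :: past),
        ← expect_one_two S hw k ((u, v) :: past), ← expect_add]
      refine expect_mono S fun l _ => ?_
      have hsu := squares_le_of_suffix (List.suffix_append l ((u, v) :: past)) u
      split_ifs with h1 h2 h3 h3 h2 h3 <;> try norm_num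
      · lia
      · lia
      · refine h3 ⟨h0, .inl (by lia), hwv.imp id ?_⟩
        rintro rfl
        lia
      · refine h3 ⟨h0, .inr ⟨hc, by lia⟩, hwv.imp id ?_⟩
        rintro rfl
        lia
  · rw [if_neg h0, if_neg (by tauto), add_zero]
    refine (expect_const S k 0 ((u, v) :: past)).ge.trans (expect_mono S fun l _ => ?_)
    split_ifs <;> norm_num

-- The index `i` counts the rounds before the current one and `k - 1 - i` those after it. The factor
-- of `b` may be negative once many circles are placed; allowing any `0 ≤ b ≤ probOneTwo n` makes it
-- possible to switch the second kind of waste off there.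
open scoped Classical in
theorem le_expect_wastedCount (hn : 2 ≤ n) {b : ℕ → ℝ} (hb0 : ∀ k, 0 ≤ b k)
    (hb : ∀ k, b k ≤ probOneTwo n k) (k : ℕ) (h : History n) :
    (n : ℝ)⁻¹ * ∑ i ∈ Finset.range k, ((1 - (n : ℝ)⁻¹) ^ i * unhit h * probZeroTwo n (k - 1 - i)
      + ((1 - (n : ℝ)⁻¹) ^ i * unhit h - (h.length + i)) * b (k - 1 - i))
      ≤ expect S k (fun H => (wastedCount H H : ℝ) - wastedCount H h) h := by
  have hn0 : (n : ℝ) ≠ 0 := by exact_mod_cast NeZero.ne n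
  induction k generalizing h with
  | zero => simp [expect]
  | succ k ih =>
    -- The bound is affine in the number of unhit vertices, so averaging over the next square only
    -- replaces `unhit h` by its mean `(1 - 1/n) * unhit h`.
    set C : ℝ := (n : ℝ)⁻¹ * ∑ i ∈ Finset.range k,
      (1 - (n : ℝ)⁻¹) ^ i * (probZeroTwo n (k - 1 - i) + b (k - 1 - i)) with hC
    set D : ℝ := (n : ℝ)⁻¹ * ∑ i ∈ Finset.range k,
      ((h.length : ℝ) + 1 + i) * b (k - 1 - i) with hD
    have hCD : ∀ z : ℝ, (n : ℝ)⁻¹ * ∑ i ∈ Finset.range k,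
        ((1 - (n : ℝ)⁻¹) ^ i * z * probZeroTwo n (k - 1 - i)
          + ((1 - (n : ℝ)⁻¹) ^ i * z - (h.length + 1 + i)) * b (k - 1 - i)) = C * z - D := by
      intro z
      rw [hC, hD, mul_assoc, Finset.sum_mul, ← mul_sub, ← Finset.sum_sub_distrib]
      congr 1
      exact Finset.sum_congr rfl fun i _ => by ring
    have hstep : ∀ u v, (if squares h u = 0 then probZeroTwo n k else 0)
        + (if squares h u = 0 ∧ u ∉ h.map Prod.snd then b k else 0)
        + (C * (unhit h - if squares h u = 0 then 1 else 0) - D)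
        ≤ expect S k (fun H => (wastedCount H H : ℝ) - wastedCount H h) ((u, v) :: h) := by
      intro u v
      have h1 := ih ((u, v) :: h)
      rw [List.length_cons, Nat.cast_add, Nat.cast_one, hCD, unhit_cons] at h1
      have h2 := le_expect_wasted S hn k h u v
      have h3 : (if squares h u = 0 ∧ u ∉ h.map Prod.snd then b k else 0)
          ≤ if squares h u = 0 ∧ u ∉ h.map Prod.snd then probOneTwo n k else 0 := by
        split_ifs
        · exact hb k
        · exact le_rfl
      refine (add_le_add ((add_le_add_right h3 _).trans h2) h1).trans ?_
      rw [← expect_add]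
      refine expect_mono S fun l _ => ?_
      rw [wastedCount]
      split_ifs <;> push_cast <;> linarith
    refine le_trans ?_ (le_expect_succ_of_square S hstep)
    rw [Finset.sum_range_succ']
    have hshift : ∀ i, k + 1 - 1 - (i + 1) = k - 1 - i := fun i => by lia
    have hs := hCD ((1 - (n : ℝ)⁻¹) * unhit h)
    have e1 : ∑ u : Fin n, (if squares h u = 0 then probZeroTwo n k else 0)
        = unhit h * probZeroTwo n k := by
      rw [← Finset.sum_filter, Finset.sum_const, nsmul_eq_mul, unhit]
    have e2 : ∑ u : Fin n, (if squares h u = 0 ∧ u ∉ h.map Prod.snd then b k else 0)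
        = (Finset.univ.filter fun x => squares h x = 0 ∧ x ∉ h.map Prod.snd).card * b k := by
      rw [← Finset.sum_filter, Finset.sum_const, nsmul_eq_mul]
    have e3 : ∑ u : Fin n, (C * ((unhit h : ℝ) - if squares h u = 0 then 1 else 0) - D)
        = n * (C * ((1 - (n : ℝ)⁻¹) * unhit h) - D) := by
      have : ∑ u : Fin n, (if squares h u = 0 then (1 : ℝ) else 0) = unhit h := by
        rw [← Finset.sum_filter, Finset.sum_const, nsmul_eq_mul, unhit, mul_one]
      rw [Finset.sum_sub_distrib, ← Finset.mul_sum, Finset.sum_sub_distrib, this]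
      simp only [Finset.sum_const, Finset.card_univ, Fintype.card_fin, nsmul_eq_mul]
      field_simp
    rw [Finset.sum_add_distrib (s := Finset.univ), Finset.sum_add_distrib (s := Finset.univ),
      e1, e2, e3, ← hs]
    have e4 := mul_le_mul_of_nonneg_right (unhit_sub_length_le h) (hb0 k)
    have e5 : (n : ℝ)⁻¹ * (n * ((n : ℝ)⁻¹ * ∑ i ∈ Finset.range k,
        ((1 - (n : ℝ)⁻¹) ^ i * ((1 - (n : ℝ)⁻¹) * unhit h) * probZeroTwo n (k - 1 - i)
          + ((1 - (n : ℝ)⁻¹) ^ i * ((1 - (n : ℝ)⁻¹) * unhit h) - (h.length + 1 + i))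
            * b (k - 1 - i))))
        = (n : ℝ)⁻¹ * ∑ i ∈ Finset.range k,
        ((1 - (n : ℝ)⁻¹) ^ (i + 1) * unhit h * probZeroTwo n (k + 1 - 1 - (i + 1))
          + ((1 - (n : ℝ)⁻¹) ^ (i + 1) * unhit h - (h.length + (i + 1 : ℕ)))
            * b (k + 1 - 1 - (i + 1))) := by
      rw [← mul_assoc (n : ℝ), mul_inv_cancel₀ hn0, one_mul]
      congr 1
      refine Finset.sum_congr rfl fun i _ => ?_
      rw [hshift]
      push_cast
      ring
    rw [mul_add, mul_add (n : ℝ)⁻¹ (unhit h * probZeroTwo n k + _), e5, add_comm]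
    refine add_le_add_left ?_ _
    refine mul_le_mul_of_nonneg_left ?_ (by positivity)
    simp only [pow_zero, one_mul, Nat.add_sub_cancel, Nat.sub_zero, Nat.cast_zero, add_zero]
    linarith

-- Pathwise, `n` times the indicator of `HAM` is at most `∑ min(squares, 2)` minus the waste; off
-- `HAM` this says that the difference is nonnegative. The sum is reindexed by the number `j` of
-- rounds to go.
open scoped Classical in
theorem mul_expect_HAM_le (hn : 2 ≤ n) {b : ℕ → ℝ} (hb0 : ∀ k, 0 ≤ b k)
    (hb : ∀ k, b k ≤ probOneTwo n k) (t : ℕ) :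
    n * expect S t ((History.graph ⁻¹' HAM n).indicator 1) []
      ≤ n * (2 - 2 * (1 - (n : ℝ)⁻¹) ^ t - (n : ℝ)⁻¹ * (t * (1 - (n : ℝ)⁻¹) ^ (t - 1)))
        - ∑ j ∈ Finset.range t, ((1 - (n : ℝ)⁻¹) ^ (t - 1 - j) * (probZeroTwo n j + b j)
          - (n : ℝ)⁻¹ * (t - 1 - j : ℕ) * b j) := by
  have hn0 : (n : ℝ) ≠ 0 := by exact_mod_cast NeZero.ne n
  have h1 : expect S t (fun H => n * (History.graph ⁻¹' HAM n).indicator 1 H) []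
      ≤ expect S t (fun H => ∑ x, ((min (squares H x) 2 : ℕ) : ℝ)
        - ((wastedCount H H : ℝ) - wastedCount H [])) [] := by
    refine expect_mono S fun H _ => ?_
    rw [List.append_nil, wastedCount, Nat.cast_zero, sub_zero]
    by_cases hH : H.graph ∈ HAM n
    · rw [Set.indicator_of_mem (by exact hH), Pi.one_apply, mul_one, le_sub_iff_add_le]
      exact_mod_cast le_of_graph_mem_HAM hn hH
    · rw [Set.indicator_of_notMem (by exact hH), mul_zero, sub_nonneg]
      have := two_mul_card_add_countP_add_wastedCount_le H
      exact_mod_cast (Nat.le_add_left _ _).trans this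
  rw [expect_const_mul, expect_sub, expect_sum] at h1
  have h2 : ∀ x, expect S t (fun H => ((min (squares H x) 2 : ℕ) : ℝ)) []
      = 2 - 2 * (1 - (n : ℝ)⁻¹) ^ t - (n : ℝ)⁻¹ * (t * (1 - (n : ℝ)⁻¹) ^ (t - 1)) := by
    intro x
    rw [expect_single S (fun i => ((min i 2 : ℕ) : ℝ)) x t [], iterate_singleStep_min,
      squares_nil]
    rfl
  simp only [h2, Finset.sum_const, Finset.card_univ, Fintype.card_fin, nsmul_eq_mul] at h1
  refine h1.trans (sub_le_sub_left ?_ _)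
  refine le_trans (le_of_eq ?_) (le_expect_wastedCount S hn hb0 hb t [])
  have hu : unhit ([] : History n) = n := by simp [unhit]
  rw [hu, ← Finset.sum_range_reflect, Finset.mul_sum]
  refine Finset.sum_congr rfl fun i hi => ?_
  have hi := Finset.mem_range.1 hi
  rw [show t - 1 - (t - 1 - i) = i by lia, List.length_nil]
  field_simp
  push_cast
  ring

theorem expect_HAM_mono {s t : ℕ} (hst : s ≤ t) (h : History n) :
    expect S s ((History.graph ⁻¹' HAM n).indicator 1) h
      ≤ expect S t ((History.graph ⁻¹' HAM n).indicator 1) h := by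
  have hone : ∀ k (h : History n), h.graph ∈ HAM n →
      expect S k ((History.graph ⁻¹' HAM n).indicator 1) h = 1 := by
    intro k h hh
    rw [← expect_const S k 1 h]
    have hl : ∀ l : History n, History.graph (l ++ h) ∈ HAM n := fun l => by
      induction l with
      | nil => exact hh
      | cons e l ih => exact graph_mem_HAM_cons ih
    exact expect_congr S fun l _ => Set.indicator_of_mem (by exact hl l) _
  induction s generalizing t h with
  | zero =>
    by_cases hh : h.graph ∈ HAM n
    · rw [hone _ h hh, hone _ h hh]
    · rw [expect, Set.indicator_of_notMem (by exact hh), ← expect_const S t 0 h]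
      exact expect_mono S fun l _ => Set.indicator_nonneg (by simp) _
  | succ s ih =>
    obtain ⟨t, rfl⟩ := Nat.exists_eq_add_of_le' hst
    rw [← add_assoc]
    exact Finset.sum_le_sum fun u _ => Finset.sum_le_sum fun v _ =>
      mul_le_mul_of_nonneg_left (ih (by lia) _) (by positivity)

end

/-! ### Comparison with the limiting densities -/

section

variable {n : ℕ}

theorem probZeroTwo_nonneg (hn : 2 ≤ n) (k : ℕ) : 0 ≤ probZeroTwo n k := by
  have h := iterate_pairStep_nonneg hn (g := fun i j => if i = 0 ∧ 2 ≤ j then 1 else 0)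
    (fun i j => by positivity) k 0 0
  rwa [iterate_pairStep_zero_two] at h

/-- Since `exp (-ν) ≤ 1 - ν + ν ^ 2`, each factor costs at most `ν ^ 2`. -/
theorem exp_sub_le_pow (hn : 2 ≤ n) (m : ℕ) :
    Real.exp (-((n : ℝ)⁻¹ * m)) - (n : ℝ)⁻¹ ^ 2 * m ≤ (1 - (n : ℝ)⁻¹) ^ m := by
  have hν := two_mul_inv_le_one hn
  have hν0 : (0 : ℝ) ≤ (n : ℝ)⁻¹ := by positivity
  set ν : ℝ := (n : ℝ)⁻¹
  have h1 : Real.exp (-ν) ≤ 1 - ν + ν ^ 2 := by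
    have := Real.abs_exp_sub_one_sub_id_le (x := -ν) (by rw [abs_neg, abs_of_nonneg hν0]; linarith)
    have := (abs_le.1 this).2
    linarith [neg_sq ν]
  induction m with
  | zero => simp
  | succ m ih =>
    have h2 : Real.exp (-(ν * (m + 1 : ℕ))) = Real.exp (-(ν * m)) * Real.exp (-ν) := by
      rw [← Real.exp_add]
      push_cast
      ring_nf
    have h3 : Real.exp (-(ν * m)) ≤ 1 := Real.exp_le_one_iff.2 (by
      have : 0 ≤ ν * m := by positivity
      linarith)
    rw [h2, pow_succ (1 - ν) m]
    have h4 := mul_le_mul_of_nonneg_right ih (show 0 ≤ 1 - ν by linarith)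
    have h5 := mul_le_mul_of_nonneg_left h1 (Real.exp_pos (-(ν * m))).le
    have h6 : 0 ≤ ν ^ 2 * m * ν := by positivity
    have h7 : 0 ≤ ν ^ 2 := by positivity
    have h8 := mul_le_mul_of_nonneg_left h3 h7
    push_cast
    linarith

theorem pow_le_exp (hn : 2 ≤ n) (m : ℕ) :
    (1 - 2 * (n : ℝ)⁻¹) ^ m ≤ Real.exp (-(2 * ((n : ℝ)⁻¹ * m))) := by
  have hν := two_mul_inv_le_one hn
  have h := pow_le_pow_left₀ (by linarith) (Real.one_sub_le_exp_neg (2 * (n : ℝ)⁻¹)) m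
  rw [← Real.exp_nat_mul] at h
  exact h.trans_eq (by ring_nf)

/-- The limit of `probZeroTwo n k` when `k / n` tends to `x`. -/
noncomputable def limZeroTwo (x : ℝ) : ℝ := Real.exp (-x) - (1 + x) * Real.exp (-(2 * x))

theorem natCast_mul_pow_pred_le {q : ℝ} (hq0 : 0 ≤ q) (hq1 : q ≤ 1) (m : ℕ) :
    m * q ^ (m - 1) ≤ m * (q ^ m + (1 - q)) := by
  rcases m with _ | m
  · simp
  · refine mul_le_mul_of_nonneg_left ?_ (by positivity)
    rw [Nat.add_sub_cancel, pow_succ]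
    nlinarith [pow_le_one₀ hq0 hq1 (n := m)]

theorem natCast_mul_pow_pred_pred_le {q : ℝ} (hq0 : 0 ≤ q) (hq1 : q ≤ 1) (m : ℕ) :
    m * (m - 1) * q ^ (m - 2) ≤ m ^ 2 * (q ^ m + 2 * (1 - q)) := by
  rcases m with _ | _ | m
  · simp
  · simp only [zero_add, Nat.cast_one, sub_self, mul_zero, zero_mul, one_pow, one_mul, pow_one]
    linarith
  · have h1 : q ^ m ≤ q ^ (m + 1 + 1) + 2 * (1 - q) := by
      rw [pow_succ, pow_succ]
      have := pow_le_one₀ hq0 hq1 (n := m)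
      have := pow_nonneg hq0 m
      nlinarith [mul_nonneg (sub_nonneg.2 hq1) (sub_nonneg.2 (pow_le_one₀ hq0 hq1 (n := m))),
        mul_nonneg (mul_nonneg (sub_nonneg.2 hq1) hq0)
          (sub_nonneg.2 (pow_le_one₀ hq0 hq1 (n := m)))]
    rw [show m + 1 + 1 - 2 = m by lia]
    refine mul_le_mul ?_ h1 (pow_nonneg hq0 m) (by positivity)
    push_cast
    nlinarith

/-- With `x = m / n ≤ 2`, the first power loses `x / n ≤ 2 / n` and the lowered exponent `m - 1`
loses `2 x / n ≤ 4 / n`. -/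
theorem limZeroTwo_sub_le (hn : 2 ≤ n) {m : ℕ} (hm : m ≤ 2 * n) :
    limZeroTwo ((n : ℝ)⁻¹ * m) - 6 * (n : ℝ)⁻¹ ≤ probZeroTwo n m := by
  have hν := two_mul_inv_le_one hn
  have hν0 : (0 : ℝ) ≤ (n : ℝ)⁻¹ := by positivity
  have hx2 : (n : ℝ)⁻¹ * m ≤ 2 := by
    rw [inv_mul_le_iff₀ (by positivity), mul_comm]; exact_mod_cast hm
  have h1 := exp_sub_le_pow hn m
  have h2 := pow_le_exp hn m
  have h3 := mul_le_mul_of_nonneg_left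
    (natCast_mul_pow_pred_le (q := 1 - 2 * (n : ℝ)⁻¹) (by linarith) (by linarith) m) hν0
  unfold limZeroTwo probZeroTwo
  set ν : ℝ := (n : ℝ)⁻¹
  have hx0 : 0 ≤ ν * m := by positivity
  have h4 := mul_le_mul_of_nonneg_left h2 hx0
  have h5 := mul_le_mul_of_nonneg_left hx2 hν0
  nlinarith

/-- The three terms lose `x ^ 2 / n`, `2 x / n` and `4 x ^ 2 / n`, in all at most `(4 + 4 + 16) /
n`. -/
theorem mul_limZeroTwo_sub_le (hn : 2 ≤ n) {m : ℕ} (hm : m ≤ 2 * n) :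
    (n : ℝ)⁻¹ * m * limZeroTwo ((n : ℝ)⁻¹ * m) - 24 * (n : ℝ)⁻¹ ≤ probOneTwo n m := by
  have hν := two_mul_inv_le_one hn
  have hν0 : (0 : ℝ) ≤ (n : ℝ)⁻¹ := by positivity
  have hx2 : (n : ℝ)⁻¹ * m ≤ 2 := by
    rw [inv_mul_le_iff₀ (by positivity), mul_comm]; exact_mod_cast hm
  have h1 := exp_sub_le_pow hn m
  have h2 := pow_le_exp hn m
  have h3 := mul_le_mul_of_nonneg_left
    (natCast_mul_pow_pred_le (q := 1 - 2 * (n : ℝ)⁻¹) (by linarith) (by linarith) m) hν0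
  have h3' := mul_le_mul_of_nonneg_left
    (natCast_mul_pow_pred_pred_le (q := 1 - 2 * (n : ℝ)⁻¹) (by linarith) (by linarith) m)
    (pow_nonneg hν0 2)
  have h0 : (1 - (n : ℝ)⁻¹) ^ m ≤ (1 - (n : ℝ)⁻¹) ^ (m - 1) :=
    pow_le_pow_of_le_one (by linarith) (by linarith) (Nat.sub_le m 1)
  unfold limZeroTwo probOneTwo
  set ν : ℝ := (n : ℝ)⁻¹
  set x : ℝ := ν * m with hx
  have hx0 : 0 ≤ x := by positivity
  have h4 := mul_le_mul_of_nonneg_left h2 hx0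
  have h4' := mul_le_mul_of_nonneg_left h2 (pow_nonneg hx0 2)
  have h5 := mul_le_mul_of_nonneg_left (h1.trans h0) hx0
  have h6 : x ^ 2 ≤ 4 := by nlinarith
  have h7 := mul_le_mul_of_nonneg_left h6 hν0
  have h8 := mul_le_mul_of_nonneg_left hx2 hν0
  have e1 : ν * (m * (1 - ν) ^ (m - 1)) = x * (1 - ν) ^ (m - 1) := by rw [hx]; ring
  have e2 : ν * (m * ((1 - 2 * ν) ^ m + (1 - (1 - 2 * ν))))
      = x * (1 - 2 * ν) ^ m + 2 * (ν * x) := by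
    rw [hx]; ring
  have e3 : ν ^ 2 * (m ^ 2 * ((1 - 2 * ν) ^ m + 2 * (1 - (1 - 2 * ν))))
      = x ^ 2 * (1 - 2 * ν) ^ m + 4 * (ν * x ^ 2) := by
    rw [hx]; ring
  have e4 : x * (Real.exp (-x) - ν ^ 2 * m) = x * Real.exp (-x) - ν * x ^ 2 := by rw [hx]; ring
  rw [e1]
  rw [e2] at h3
  rw [e3] at h3'
  rw [e4] at h5
  linarith

theorem probZeroTwo_le_one (hn : 2 ≤ n) (m : ℕ) : probZeroTwo n m ≤ 1 := by
  have hν := two_mul_inv_le_one hn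
  have hν0 : (0 : ℝ) ≤ (n : ℝ)⁻¹ := by positivity
  have hq : 0 ≤ 1 - 2 * (n : ℝ)⁻¹ := by linarith
  have h1 : (1 - (n : ℝ)⁻¹) ^ m ≤ 1 := pow_le_one₀ (by linarith) (by linarith)
  have h2 : 0 ≤ (1 - 2 * (n : ℝ)⁻¹) ^ m := pow_nonneg hq m
  have h3 : 0 ≤ (n : ℝ)⁻¹ * (m * (1 - 2 * (n : ℝ)⁻¹) ^ (m - 1)) := by positivity
  unfold probZeroTwo
  linarith

theorem probOneTwo_le_two (hn : 2 ≤ n) {m : ℕ} (hm : m ≤ 2 * n) : probOneTwo n m ≤ 2 := by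
  have hν := two_mul_inv_le_one hn
  have hν0 : (0 : ℝ) ≤ (n : ℝ)⁻¹ := by positivity
  have hq : 0 ≤ 1 - 2 * (n : ℝ)⁻¹ := by linarith
  have hx2 : (n : ℝ)⁻¹ * m ≤ 2 := by
    rw [inv_mul_le_iff₀ (by positivity), mul_comm]; exact_mod_cast hm
  have h1 : (1 - (n : ℝ)⁻¹) ^ (m - 1) ≤ 1 := pow_le_one₀ (by linarith) (by linarith)
  have h2 : (n : ℝ)⁻¹ * (m * (1 - (n : ℝ)⁻¹) ^ (m - 1)) ≤ 2 := by
    rw [← mul_assoc]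
    exact (mul_le_of_le_one_right (by positivity) h1).trans hx2
  have h3 : 0 ≤ (n : ℝ)⁻¹ * (m * (1 - 2 * (n : ℝ)⁻¹) ^ (m - 1)) := by positivity
  have h4 : 0 ≤ (n : ℝ)⁻¹ ^ 2 * (m * (m - 1) * (1 - 2 * (n : ℝ)⁻¹) ^ (m - 2)) := by
    have : (0 : ℝ) ≤ m * (m - 1) := by
      rcases m with _ | m
      · simp
      · push_cast
        nlinarith [(Nat.cast_nonneg m : (0 : ℝ) ≤ m)]
    positivity
  unfold probOneTwo
  linarith

end

/-! ### Riemann sums and rational bounds for the exponential -/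

/-- Left Riemann sums of a continuous function with a given antiderivative. -/
theorem exists_le_sum_Ico {F Φ : ℝ → ℝ} (hF : Continuous F) (hΦ : ∀ x, HasDerivAt Φ (F x) x)
    {ε : ℝ} (hε : 0 < ε) : ∃ N : ℕ, ∀ n : ℕ, N ≤ n → 0 < n → ∀ a b : ℕ, a ≤ b → b ≤ 2 * n →
      n * (Φ ((n : ℝ)⁻¹ * b) - Φ ((n : ℝ)⁻¹ * a)) - ε * (b - a)
        ≤ ∑ j ∈ Finset.Ico a b, F ((n : ℝ)⁻¹ * j) := by
  have huc := isCompact_Icc.uniformContinuousOn_of_continuous (hF.continuousOn (s := Set.Icc 0 2))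
  obtain ⟨δ, hδ, huc⟩ := Metric.uniformContinuousOn_iff.1 huc ε hε
  obtain ⟨N, hN⟩ := exists_nat_gt δ⁻¹
  refine ⟨N, fun n hNn hn a b hab => ?_⟩
  have hn' : (0 : ℝ) < n := by exact_mod_cast hn
  have hνδ : (n : ℝ)⁻¹ < δ := by
    rw [inv_lt_comm₀ hn' hδ]
    exact hN.trans_le (by exact_mod_cast hNn)
  have hν0 : 0 < (n : ℝ)⁻¹ := by positivity
  induction b, hab using Nat.le_induction with
  | base => intro _; simp
  | succ b hab ih =>
    intro hb
    have ih := ih (by lia)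
    rw [Finset.sum_Ico_succ_top hab]
    have hb2 : (n : ℝ)⁻¹ * (b + 1) ≤ 2 := by
      rw [inv_mul_le_iff₀ hn', mul_comm]; exact_mod_cast hb
    have hb0 : 0 ≤ (n : ℝ)⁻¹ * b := by positivity
    -- The mean value theorem turns the increment of `Φ` over one cell into a value of `F` within
    -- `δ` of the left endpoint.
    obtain ⟨ξ, hξ, hξ'⟩ := exists_hasDerivAt_eq_slope Φ F
      (show (n : ℝ)⁻¹ * b < (n : ℝ)⁻¹ * (b + 1) by nlinarith)
      (fun x _ => (hΦ x).continuousAt.continuousWithinAt) (fun x _ => hΦ x)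
    have h1 : Φ ((n : ℝ)⁻¹ * (b + 1)) - Φ ((n : ℝ)⁻¹ * b) = (n : ℝ)⁻¹ * F ξ := by
      rw [hξ']
      field_simp
      ring
    have h2 := huc ξ ⟨hb0.trans hξ.1.le, hξ.2.le.trans hb2⟩ ((n : ℝ)⁻¹ * b)
      ⟨hb0, by nlinarith⟩ (by
        rw [Real.dist_eq, abs_of_nonneg (by linarith [hξ.1])]
        nlinarith [hξ.2])
    rw [Real.dist_eq] at h2
    have h3 := (abs_lt.1 h2).2
    have h4 : (n : ℝ) * ((n : ℝ)⁻¹ * F ξ) = F ξ := by field_simp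
    push_cast
    nlinarith

/-- Rational bounds for `exp (-x)` from the Taylor polynomial at `-x / 2`. -/
theorem exp_neg_bounds {x : ℝ} (hx0 : 0 ≤ x) (hx2 : x ≤ 2) {lo hi : ℝ} (hlo0 : 0 ≤ lo)
    (hlo : lo ≤ ∑ m ∈ Finset.range 14, (-(x / 2)) ^ m / m.factorial - 1 / 80000000000)
    (hhi : ∑ m ∈ Finset.range 14, (-(x / 2)) ^ m / m.factorial + 1 / 80000000000 ≤ hi) :
    lo ^ 2 ≤ Real.exp (-x) ∧ Real.exp (-x) ≤ hi ^ 2 := by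
  -- Halving brings the argument into `[-1, 1]`, where the Taylor remainder bound applies; the
  -- result is squared at the end.
  have h := Real.exp_bound (x := -(x / 2)) (by rw [abs_neg, abs_of_nonneg] <;> linarith)
    (n := 14) (by norm_num)
  have h1 : |-(x / 2)| ^ 14 * ((Nat.succ 14 : ℕ) / ((Nat.factorial 14 : ℕ) * (14 : ℕ)) : ℝ)
      ≤ 1 / 80000000000 := by
    have : |-(x / 2)| ^ 14 ≤ 1 :=
      pow_le_one₀ (abs_nonneg _) (by rw [abs_neg, abs_of_nonneg] <;> linarith)
    refine (mul_le_of_le_one_left (by positivity) this).trans ?_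
    norm_num [Nat.factorial]
  have h2 := abs_le.1 (h.trans h1)
  have h3 : Real.exp (-x) = Real.exp (-(x / 2)) ^ 2 := by
    rw [← Real.exp_nat_mul]
    ring_nf
  rw [h3]
  constructor
  · exact pow_le_pow_left₀ hlo0 (by linarith [h2.1]) 2
  · exact pow_le_pow_left₀ (Real.exp_pos _).le (by linarith [h2.2]) 2

/-! ### The equation `f s = 1` -/

/-- `f s = 2 - exp (-s) * (2 + s) - exp (-s) * (1 + s) * lossFactor s`. -/
noncomputable def lossFactor (s : ℝ) : ℝ :=
  1 - Real.exp (-s) * (2 * s + s ^ 2 / 2)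
    - Real.exp (-s) ^ 2 * (1 - s ^ 2 / 2 - s ^ 3 / 3 - s ^ 4 / 8)

theorem f_eq (s : ℝ) : f s = 2
    + Real.exp (-s) ^ 3 * (s + 1) * (1 - s ^ 2 / 2 - s ^ 3 / 3 - s ^ 4 / 8)
    + Real.exp (-s) ^ 2 * (2 * s + 5 * s ^ 2 / 2 + s ^ 3 / 2) - Real.exp (-s) * (3 + 2 * s) := by
  rw [f, ← Real.exp_nat_mul, ← Real.exp_nat_mul]
  norm_num

/-- After multiplication by `exp (2 * s)`, the cubic Taylor polynomial is a good enough lower bound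
for both factors `exp s`. -/
theorem lossFactor_nonneg {s : ℝ} (hs : 0 ≤ s) : 0 ≤ lossFactor s := by
  have h1 : 1 + s + s ^ 2 / 2 + s ^ 3 / 6 ≤ Real.exp s := by
    have := Real.sum_le_exp_of_nonneg hs 4
    simp only [Finset.sum_range_succ, Finset.sum_range_zero, Nat.factorial] at this
    norm_num at this
    linarith
  have h2 : 0 ≤ 1 - s + s ^ 3 / 6 := by
    nlinarith [mul_nonneg hs (sq_nonneg (s - 3 / 2)), sq_nonneg (s - 3 / 2), sq_nonneg (s - 7 / 5),
      mul_nonneg hs (sq_nonneg (s - 7 / 5))]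
  have h3 : 1 - s ^ 2 / 2 - s ^ 3 / 3 - s ^ 4 / 8
      ≤ Real.exp s * (Real.exp s - 2 * s - s ^ 2 / 2) := by
    calc 1 - s ^ 2 / 2 - s ^ 3 / 3 - s ^ 4 / 8
        ≤ (1 + s + s ^ 2 / 2 + s ^ 3 / 6) * (1 - s + s ^ 3 / 6) := by
          have h3 := pow_nonneg hs 3
          have h4 := pow_nonneg hs 4
          have h5 := pow_nonneg hs 5
          have h6 := pow_nonneg hs 6
          nlinarith
      _ ≤ _ := mul_le_mul h1 (by linarith) h2 (Real.exp_pos s).le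
  have h4 : Real.exp (-s) * Real.exp s = 1 := by rw [← Real.exp_add]; simp
  have h5 := mul_le_mul_of_nonneg_left h3 (sq_nonneg (Real.exp (-s)))
  have h6 : Real.exp (-s) ^ 2 * (Real.exp s * (Real.exp s - 2 * s - s ^ 2 / 2))
      = 1 - Real.exp (-s) * (2 * s + s ^ 2 / 2) := by
    linear_combination (Real.exp (-s) * Real.exp s + 1 - Real.exp (-s) * (2 * s + s ^ 2 / 2)) * h4
  unfold lossFactor
  linarith

/-- The inner bracket subtracted from `1` is the derivative of `lossFactor`. -/
theorem hasDerivAt_f (s : ℝ) : HasDerivAt f (Real.exp (-s) * ((1 + s) *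
    (1 - (Real.exp (-s) * (s ^ 2 / 2 + s - 2)
      + Real.exp (-s) ^ 2 * (2 + s - s ^ 3 / 6 - s ^ 4 / 4))) + s * lossFactor s)) s := by
  have hE : HasDerivAt (fun s => Real.exp (-s)) (Real.exp (-s) * -1) s :=
    (hasDerivAt_neg s).exp
  have hid := hasDerivAt_id' s
  rw [show f = _ from funext f_eq]
  have := ((((hE.pow 3).mul (hid.add_const 1)).mul
    ((((hid.pow 2).div_const 2).const_sub 1).sub ((hid.pow 3).div_const 3)|>.sub
      ((hid.pow 4).div_const 8))).const_add 2).add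
    ((hE.pow 2).mul (((hid.const_mul 2).add (((hid.pow 2).const_mul 5).div_const 2)).add
      ((hid.pow 3).div_const 2))) |>.sub (hE.mul ((hid.const_mul 2).const_add 3))
  refine this.congr_deriv ?_
  simp only [lossFactor, Pi.mul_apply, Pi.pow_apply, Pi.add_apply,
    Pi.sub_apply]
  push_cast
  ring

theorem strictMonoOn_f : StrictMonoOn f (Set.Ici 0) := by
  refine strictMonoOn_of_deriv_pos (convex_Ici 0)
    (fun s _ => (hasDerivAt_f s).continuousAt.continuousWithinAt) fun s hs => ?_
  rw [interior_Ici, Set.mem_Ioi] at hs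
  rw [(hasDerivAt_f s).deriv]
  have hE := Real.exp_pos (-s)
  have hL := lossFactor_nonneg hs.le
  set E := Real.exp (-s)
  have h1 : E * (1 + s + s ^ 2 / 2) ≤ 1 := by
    have h := Real.quadratic_le_exp_of_nonneg hs.le
    calc E * (1 + s + s ^ 2 / 2) ≤ E * Real.exp s := mul_le_mul_of_nonneg_left h hE.le
      _ = 1 := by rw [← Real.exp_add]; simp
  have h2 : E * (1 + s) ≤ 1 := by nlinarith [mul_pos hE (pow_pos hs 2)]
  have hE1 : E < 1 := by rw [← Real.exp_zero]; exact Real.exp_lt_exp.2 (by linarith)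
  have h3 : E ^ 2 * (2 + s - s ^ 3 / 6 - s ^ 4 / 4) ≤ E * 2 := by
    have : E * (E * (2 + s - s ^ 3 / 6 - s ^ 4 / 4)) ≤ E * 2 := by
      refine mul_le_mul_of_nonneg_left ?_ hE.le
      have := mul_nonneg hE.le (pow_nonneg hs.le 3)
      have := mul_nonneg hE.le (pow_nonneg hs.le 4)
      nlinarith
    linarith
  -- By `h3` the subtracted bracket is at most `E * (s + s ^ 2 / 2)`, which by `h1` is at most `1 -
  -- E`.
  have h4 : 0 < 1 - (E * (s ^ 2 / 2 + s - 2) + E ^ 2 * (2 + s - s ^ 3 / 6 - s ^ 4 / 4)) := by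
    nlinarith
  positivity

theorem f_lt_one : f 1.26575 < 1 := by
  obtain ⟨h1, h2⟩ := exp_neg_bounds (x := 1.26575) (by norm_num) (by norm_num)
    (lo := 0.5310627985) (hi := 0.5310627986) (by norm_num)
    (by simp only [Finset.sum_range_succ, Finset.sum_range_zero, Nat.factorial]; norm_num)
    (by simp only [Finset.sum_range_succ, Finset.sum_range_zero, Nat.factorial]; norm_num)
  rw [f_eq]
  set E := Real.exp (-1.26575)
  have h3 := pow_le_pow_left₀ (by norm_num) h1 3
  have h4 := pow_le_pow_left₀ (by linarith) h2 2
  norm_num at h1 h2 h3 h4 ⊢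
  linarith

theorem one_lt_f : 1 < f 1.26576 := by
  obtain ⟨h1, h2⟩ := exp_neg_bounds (x := 1.26576) (by norm_num) (by norm_num)
    (lo := 0.5310601432) (hi := 0.5310601433) (by norm_num)
    (by simp only [Finset.sum_range_succ, Finset.sum_range_zero, Nat.factorial]; norm_num)
    (by simp only [Finset.sum_range_succ, Finset.sum_range_zero, Nat.factorial]; norm_num)
  rw [f_eq]
  set E := Real.exp (-1.26576)
  have h3 := pow_le_pow_left₀ (by linarith) h2 3
  have h4 := pow_le_pow_left₀ (by norm_num) h1 2
  norm_num at h1 h2 h3 h4 ⊢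
  linarith

theorem exists_root_f : ∃ β : ℝ, (0 < β ∧ f β = 1 ∧ ∀ s : ℝ, 0 < s → f s = 1 → s = β) ∧
    (1.26575 < β ∧ β < 1.26576) := by
  obtain ⟨β, ⟨h1, h2⟩, hβ⟩ := intermediate_value_Ioo (show (1.26575 : ℝ) ≤ 1.26576 by norm_num)
    (f := f) (fun s _ => (hasDerivAt_f s).continuousAt.continuousWithinAt) ⟨f_lt_one, one_lt_f⟩
  have h0 : 0 < β := lt_trans (by norm_num) h1
  exact ⟨β, ⟨h0, hβ, fun s hs hfs =>
    strictMonoOn_f.injOn hs.le h0.le (hfs.trans hβ.symm)⟩, h1, h2⟩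

/-! ### The limiting waste at `s = 633 / 500` -/

/-- The limiting density of the wasted rounds whose square is on a vertex with one square. -/
noncomputable def wasteOne (s x : ℝ) : ℝ := Real.exp (-s) * (1 - (1 + x) * Real.exp (-x))

/-- The limiting density of the wasted rounds whose square is on a vertex with two squares. -/
noncomputable def wasteTwo (s x : ℝ) : ℝ := x * wasteOne s x - (s - x) * (x * limZeroTwo x)

/-- An antiderivative of `wasteOne s`. -/
noncomputable def wasteOnePrim (s x : ℝ) : ℝ :=
  Real.exp (-s) * (x + (2 + x) * Real.exp (-x))

/-- An antiderivative of `wasteTwo s`. -/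
noncomputable def wasteTwoPrim (s x : ℝ) : ℝ :=
  Real.exp (-s) * (x ^ 2 / 2 + (x ^ 2 + 3 * x + 3) * Real.exp (-x))
    - (x ^ 2 + (2 - s) * x + (2 - s)) * Real.exp (-x)
    + ((x ^ 3 + (1 - s) * x ^ 2 - s * x) / 2 + (3 * x ^ 2 + 2 * (1 - s) * x - s) / 4
      + (3 * x + (1 - s)) / 4 + 3 / 8) * Real.exp (-x) ^ 2

theorem limZeroTwo_eq (x : ℝ) :
    limZeroTwo x = Real.exp (-x) - (1 + x) * Real.exp (-x) ^ 2 := by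
  rw [limZeroTwo, ← Real.exp_nat_mul]
  ring_nf

theorem hasDerivAt_wasteOnePrim (s x : ℝ) : HasDerivAt (wasteOnePrim s) (wasteOne s x) x := by
  have hE : HasDerivAt (fun x => Real.exp (-x)) (Real.exp (-x) * -1) x := (hasDerivAt_neg x).exp
  have hid := hasDerivAt_id' x
  have h := (hid.fun_add ((hid.const_add 2).fun_mul hE)).const_mul (Real.exp (-s))
  refine h.congr_deriv ?_
  rw [wasteOne]
  ring

theorem hasDerivAt_wasteTwoPrim (s x : ℝ) : HasDerivAt (wasteTwoPrim s) (wasteTwo s x) x := by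
  have hE : HasDerivAt (fun x => Real.exp (-x)) (Real.exp (-x) * -1) x := (hasDerivAt_neg x).exp
  have hid := hasDerivAt_id' x
  have h2 := hid.fun_pow 2
  have h3 := hid.fun_pow 3
  have ha := ((h2.div_const 2).fun_add (((h2.fun_add (hid.const_mul 3)).add_const 3).fun_mul
    hE)).const_mul (Real.exp (-s))
  have hb := ((h2.fun_add (hid.const_mul (2 - s))).add_const (2 - s)).fun_mul hE
  have hc := (((((h3.fun_add (h2.const_mul (1 - s))).fun_sub (hid.const_mul s)).div_const 2).fun_add
    ((((h2.const_mul 3).fun_add (hid.const_mul (2 * (1 - s)))).sub_const s).div_const 4)).fun_add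
    (((hid.const_mul 3).add_const (1 - s)).div_const 4)).add_const (3 / 8) |>.fun_mul (hE.fun_pow 2)
  refine ((ha.fun_sub hb).fun_add hc).congr_deriv ?_
  rw [wasteTwo, wasteOne, limZeroTwo_eq]
  push_cast
  ring

theorem continuous_wasteOne (s : ℝ) : Continuous (wasteOne s) := by
  unfold wasteOne
  fun_prop

theorem continuous_wasteTwo (s : ℝ) : Continuous (wasteTwo s) := by
  unfold wasteTwo wasteOne limZeroTwo
  fun_prop

/-- Here `383 / 500 = 633 / 500 - 1 / 2`: waste on vertices with two squares is counted only in the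
first `n / 2` rounds. Without it the left side would exceed `1`. -/
theorem waste_bound :
    2 - (2 + 633 / 500) * Real.exp (-(633 / 500))
      - (wasteOnePrim (633 / 500) (633 / 500) - wasteOnePrim (633 / 500) 0)
      - (wasteTwoPrim (633 / 500) (633 / 500) - wasteTwoPrim (633 / 500) (383 / 500))
      < 998 / 1000 := by
  obtain ⟨h1, h2⟩ := exp_neg_bounds (x := 633 / 500) (by norm_num) (by norm_num)
    (lo := 0.53099641) (hi := 0.53099643) (by norm_num)
    (by simp only [Finset.sum_range_succ, Finset.sum_range_zero, Nat.factorial]; norm_num)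
    (by simp only [Finset.sum_range_succ, Finset.sum_range_zero, Nat.factorial]; norm_num)
  obtain ⟨h3, h4⟩ := exp_neg_bounds (x := 383 / 500) (by norm_num) (by norm_num)
    (lo := 0.68181289) (hi := 0.68181291) (by norm_num)
    (by simp only [Finset.sum_range_succ, Finset.sum_range_zero, Nat.factorial]; norm_num)
    (by simp only [Finset.sum_range_succ, Finset.sum_range_zero, Nat.factorial]; norm_num)
  unfold wasteOnePrim wasteTwoPrim
  rw [neg_zero, Real.exp_zero]
  set E := Real.exp (-(633 / 500))
  set H := Real.exp (-(383 / 500))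
  have hE0 : 0 ≤ E := (Real.exp_pos _).le
  have hH0 : 0 ≤ H := (Real.exp_pos _).le
  have h5 := pow_le_pow_left₀ (by norm_num) h1 2
  have h6 := pow_le_pow_left₀ hE0 h2 2
  have h7 := pow_le_pow_left₀ (by norm_num) h3 2
  have h8 := pow_le_pow_left₀ hH0 h4 2
  have h9 := mul_le_mul h1 h3 (by norm_num) hE0
  have h10 := mul_le_mul h2 h4 hH0 (by norm_num)
  norm_num at h1 h2 h3 h4 h5 h6 h7 h8 h9 h10 ⊢
  linarith

/-- The expected number of wasted rounds with `j` rounds to go is at least its limit, up to an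
error of order `1 / n`. -/
theorem waste_le_term {n t j r : ℕ} (hn : 2 ≤ n) (ht : t ≤ 2 * n) (hj : j < t)
    (hr : ∀ i, r ≤ i → 2 * (t - i) ≤ n) :
    wasteOne ((n : ℝ)⁻¹ * t) ((n : ℝ)⁻¹ * j)
      + (if r ≤ j then wasteTwo ((n : ℝ)⁻¹ * t) ((n : ℝ)⁻¹ * j) else 0) - 36 * (n : ℝ)⁻¹
      ≤ (1 - (n : ℝ)⁻¹) ^ (t - 1 - j) * (probZeroTwo n j + if r ≤ j then probOneTwo n j else 0)
          - (n : ℝ)⁻¹ * (t - 1 - j : ℕ) * if r ≤ j then probOneTwo n j else 0 := by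
  have hn0 : (0 : ℝ) < n := by positivity
  have hν := two_mul_inv_le_one hn
  have hν0 : (0 : ℝ) ≤ (n : ℝ)⁻¹ := by positivity
  have hj2 : j ≤ 2 * n := hj.le.trans ht
  have ha := limZeroTwo_sub_le hn hj2
  have ha0 := probZeroTwo_nonneg hn j
  have ha1 := probZeroTwo_le_one hn j
  have hb := mul_limZeroTwo_sub_le hn hj2
  have hb0 := probOneTwo_nonneg hn j
  have hb1 := probOneTwo_le_two hn hj2
  have hp := exp_sub_le_pow hn (t - j)
  have hpm : (1 - (n : ℝ)⁻¹) ^ (t - j) ≤ (1 - (n : ℝ)⁻¹) ^ (t - 1 - j) :=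
    pow_le_pow_of_le_one (by linarith) (by linarith) (by lia)
  have hcast : ((t - j : ℕ) : ℝ) = t - j := Nat.cast_sub hj.le
  have hy2 : (n : ℝ)⁻¹ * (t - j : ℕ) ≤ 2 := by
    rw [inv_mul_le_iff₀ hn0, mul_comm]; exact_mod_cast (by lia : t - j ≤ 2 * n)
  have hyr : (n : ℝ)⁻¹ * (t - 1 - j : ℕ) ≤ (n : ℝ)⁻¹ * (t - j : ℕ) :=
    mul_le_mul_of_nonneg_left (by exact_mod_cast (by lia)) hν0
  have hys : (n : ℝ)⁻¹ * (t - j : ℕ) = (n : ℝ)⁻¹ * t - (n : ℝ)⁻¹ * j := by rw [hcast]; ring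
  -- For `y ≤ 1 / 2` the factor `exp (-y) - y ≥ 1 - 2 * y` is nonnegative, so lower bounds may be
  -- multiplied by it.
  have hycut : r ≤ j → (n : ℝ)⁻¹ * (t - j : ℕ) ≤ 1 / 2 := fun h => by
    rw [inv_mul_le_iff₀ hn0]
    have : (2 : ℝ) * (t - j : ℕ) ≤ n := by exact_mod_cast hr j h
    linarith
  set ν : ℝ := (n : ℝ)⁻¹
  set s : ℝ := ν * t
  set x : ℝ := ν * j
  set y : ℝ := ν * (t - j : ℕ) with hy
  have hy0 : 0 ≤ y := by positivity
  have hD1 : Real.exp (-y) ≤ 1 := Real.exp_le_one_iff.2 (by linarith)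
  have hD0 := Real.exp_pos (-y)
  have hDE : Real.exp (-y) * Real.exp (-x) = Real.exp (-s) := by
    rw [← Real.exp_add]
    congr 1
    linarith
  have hF1 : Real.exp (-y) * limZeroTwo x = wasteOne s x := by
    rw [wasteOne, limZeroTwo_eq, ← hDE]
    ring
  have hF2 : wasteTwo s x = (Real.exp (-y) - y) * (x * limZeroTwo x) := by
    rw [wasteTwo, ← hF1, hys]
    ring
  have hDy := Real.one_sub_le_exp_neg y
  have hp' : Real.exp (-y) - 2 * ν ≤ (1 - ν) ^ (t - 1 - j) := by
    have : ν ^ 2 * (t - j : ℕ) = ν * y := by rw [hy]; ring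
    rw [this] at hp
    have := mul_le_mul_of_nonneg_left hy2 hν0
    linarith
  -- The error is `2 ν` from the power and `6 ν` from `probZeroTwo`.
  have h1 : wasteOne s x - 8 * ν ≤ (1 - ν) ^ (t - 1 - j) * probZeroTwo n j := by
    have e1 := mul_le_mul_of_nonneg_right hp' ha0
    have e2 := mul_le_mul_of_nonneg_left ha hD0.le
    have e3 := mul_le_mul_of_nonneg_left ha1 hν0
    have e4 := mul_le_mul_of_nonneg_left hD1 hν0
    rw [← hF1]
    nlinarith
  split_ifs with hrj
  · have hy1 := hycut hrj
    -- The error is `2 ν * 2` from the power, as `probOneTwo ≤ 2`, and `24 ν` from `probOneTwo`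
    -- itself.
    have h2 : wasteTwo s x - 28 * ν
        ≤ ((1 - ν) ^ (t - 1 - j) - ν * (t - 1 - j : ℕ)) * probOneTwo n j := by
      have e1 := mul_le_mul_of_nonneg_right
        (show Real.exp (-y) - 2 * ν - y ≤ (1 - ν) ^ (t - 1 - j) - ν * (t - 1 - j : ℕ) by linarith)
        hb0
      have e2 := mul_le_mul_of_nonneg_left hb (show 0 ≤ Real.exp (-y) - y by linarith)
      have e3 := mul_le_mul_of_nonneg_left hb1 hν0
      have e4 := mul_le_mul_of_nonneg_left (show Real.exp (-y) - y ≤ 1 by linarith) hν0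
      rw [hF2]
      nlinarith
    linarith
  · linarith

/-! ### The lower bound for `τ` -/

theorem exists_expect_HAM_le : ∃ K : ℕ, ∀ k : ℕ, K ≤ k → ∀ (_ : NeZero (500 * k))
    (S : Strategy (500 * k)),
    expect S (633 * k) ((History.graph ⁻¹' HAM (500 * k)).indicator 1) [] ≤ 999 / 1000 := by
  obtain ⟨N₁, hN₁⟩ := exists_le_sum_Ico (continuous_wasteOne (633 / 500))
    (hasDerivAt_wasteOnePrim (633 / 500)) (ε := 1 / 10000) (by norm_num)
  obtain ⟨N₂, hN₂⟩ := exists_le_sum_Ico (continuous_wasteTwo (633 / 500))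
    (hasDerivAt_wasteTwoPrim (633 / 500)) (ε := 1 / 10000) (by norm_num)
  -- With `n ≥ 5000000`, the bounded errors and the two Riemann errors `ε` per term fit between
  -- `0.998 n` and `0.999 n`.
  refine ⟨N₁ + N₂ + 10000, fun k hk _ S => ?_⟩
  have hk0 : (0 : ℝ) < k := by exact_mod_cast (by lia : 0 < k)
  have hn : 2 ≤ 500 * k := by lia
  have hc : ∀ c : ℕ, (((500 * k : ℕ) : ℝ))⁻¹ * (c * k : ℕ) = c / 500 := fun c => by
    push_cast
    field_simp
  have h1 := hN₁ (500 * k) (by lia) (by lia) 0 (633 * k) (by lia) (by lia)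
  have h2 := hN₂ (500 * k) (by lia) (by lia) (383 * k) (633 * k) (by lia) (by lia)
  have h3 := mul_expect_HAM_le S hn
    (b := fun j => if 383 * k ≤ j then probOneTwo (500 * k) j else 0)
    (fun j => by split_ifs; exacts [probOneTwo_nonneg hn j, le_rfl])
    (fun j => by split_ifs; exacts [le_rfl, probOneTwo_nonneg hn j]) (633 * k)
  have h4 := Finset.sum_le_sum fun j (hj : j ∈ Finset.range (633 * k)) =>
    waste_le_term (r := 383 * k) hn (by lia : 633 * k ≤ 2 * (500 * k)) (Finset.mem_range.1 hj)
      (fun i hi => by lia)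
  have h5 := exp_sub_le_pow hn (633 * k)
  have h6 : (1 - ((500 * k : ℕ) : ℝ)⁻¹) ^ (633 * k)
      ≤ (1 - ((500 * k : ℕ) : ℝ)⁻¹) ^ (633 * k - 1) := by
    have := two_mul_inv_le_one hn
    have : (0 : ℝ) ≤ ((500 * k : ℕ) : ℝ)⁻¹ := by positivity
    exact pow_le_pow_of_le_one (by linarith) (by linarith) (Nat.sub_le _ _)
  have hfilter : (Finset.range (633 * k)).filter (fun j => 383 * k ≤ j)
      = Finset.Ico (383 * k) (633 * k) := by
    ext j
    simp only [Finset.mem_filter, Finset.mem_range, Finset.mem_Ico]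
    tauto
  rw [Finset.sum_sub_distrib, Finset.sum_add_distrib, ← Finset.sum_filter, hfilter,
    Finset.sum_const, Finset.card_range, nsmul_eq_mul, hc] at h4
  rw [hc, Nat.cast_zero, mul_zero, ← Finset.range_eq_Ico] at h1
  rw [hc, hc] at h2
  rw [hc] at h5
  have h7 := waste_bound
  have hN : (5000000 : ℝ) ≤ ((500 * k : ℕ) : ℝ) := by
    exact_mod_cast (by lia : 5000000 ≤ 500 * k)
  have hNν : ((500 * k : ℕ) : ℝ) * ((500 * k : ℕ) : ℝ)⁻¹ = 1 := mul_inv_cancel₀ (by linarith)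
  have hkN : ((633 * k : ℕ) : ℝ) = 633 / 500 * ((500 * k : ℕ) : ℝ) := by push_cast; ring
  have hkN' : ((383 * k : ℕ) : ℝ) = 383 / 500 * ((500 * k : ℕ) : ℝ) := by push_cast; ring
  rw [← mul_assoc, hc] at h3
  rw [pow_two, mul_assoc, hc] at h5
  simp only [Nat.cast_ofNat] at h1 h2 h3 h4 h5
  rw [hkN] at h1 h4
  rw [hkN, hkN'] at h2
  set P := expect S (633 * k) ((History.graph ⁻¹' HAM (500 * k)).indicator 1) []
  generalize ((500 * k : ℕ) : ℝ) = N at *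
  have hN0 : 0 ≤ N := by linarith
  have h8 := mul_le_mul_of_nonneg_left (h5.trans h6) hN0
  have h9 := mul_le_mul_of_nonneg_left h5 hN0
  have h10 := mul_le_mul_of_nonneg_left h7.le hN0
  have h11 : N * (Real.exp (-(633 / 500)) - N⁻¹ * (633 / 500))
      = N * Real.exp (-(633 / 500)) - 633 / 500 := by
    linear_combination (-(633 / 500)) * hNν
  have h12 : 633 / 500 * N * (36 * N⁻¹) = 633 / 500 * 36 := by
    linear_combination (633 / 500 * 36) * hNν
  rw [h11] at h8 h9
  rw [h12] at h4
  refine le_of_mul_le_mul_left ?_ (show 0 < N by linarith)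
  linarith

/-- A limsup is bounded below by its values along the multiples of `500`, for which `633 n / 500` is
an integer, and only `q > 0.999` matters as `q → 1⁻`. -/
theorem le_tau_HAM : ENNReal.ofReal (633 / 500) ≤ tau HAM := by
  obtain ⟨K, hK⟩ := exists_expect_HAM_le
  refine ge_of_tendsto (tendsto_tau HAM) ?_
  filter_upwards [Ioo_mem_nhdsLT (show (999 / 1000 : ℝ) < 1 by norm_num)] with q hq
  refine le_limsup_of_frequently_le ?_
  refine frequently_atTop.2 fun N => ?_
  have hpos : 0 < 500 * (K + N) := by have := N.pos; lia
  refine ⟨⟨500 * (K + N), hpos⟩, ?_, ?_⟩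
  · change (N : ℕ) ≤ 500 * (K + N)
    lia
  rw [ENNReal.le_div_iff_mul_le (.inl (by simp)) (.inl (ENNReal.natCast_ne_top _))]
  refine le_iInf fun S => le_iInf₂ fun t ht => ?_
  rw [toOuterMeasure_graphLaw, ENNReal.ofReal_le_ofReal_iff'] at ht
  -- The probability of `HAM` never decreases in time, so the bound at round `633 * (K + N)`
  -- excludes all earlier rounds as well.
  have htlt : 633 * (K + N) < t := by
    by_contra! hle
    have : NeZero (500 * (K + N)) := ⟨hpos.ne'⟩
    have h1 := expect_HAM_mono (n := 500 * (K + N)) S hle []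
    have h2 := hK (K + N) (by lia) this S
    rcases ht with ht | ht
    · exact absurd (ht.trans (h1.trans h2)) (not_le.2 hq.1)
    · linarith [hq.1]
  rw [PNat.mk_coe, ← ENNReal.ofReal_natCast, ← ENNReal.ofReal_natCast,
    ← ENNReal.ofReal_mul (by norm_num)]
  refine ENNReal.ofReal_le_ofReal ?_
  have : ((633 * (K + N) : ℕ) : ℝ) ≤ t := by exact_mod_cast htlt.le
  push_cast at this ⊢
  linarith

end SemiRandom

theorem theorem2 :
    ∃ β : ℝ,
      (0 < β ∧ SemiRandom.f β = 1 ∧ ∀ s : ℝ, 0 < s → SemiRandom.f s = 1 → s = β) ∧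
      (1.26575 < β ∧ β < 1.26576) ∧
      ENNReal.ofReal β ≤ SemiRandom.tau SemiRandom.HAM := by
  obtain ⟨β, hβ, hβ'⟩ := SemiRandom.exists_root_f
  refine ⟨β, hβ, hβ', le_trans (ENNReal.ofReal_le_ofReal ?_) SemiRandom.le_tau_HAM⟩
  have := hβ'.2
  norm_num at this ⊢
  linarith
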